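/- Let $(Y,X,W_1,W_2)$ be random with $Y,X$ and $W_2$ scalar and $W_1\in\mathbb R^{d}$; $(Y,X,W_1)$ is observed and $W_2$ is not. All regressions are population OLS regressions with an intercept. Let $\beta_{\mathrm{med}}$, $\gamma_{1,\mathrm{med}}$, $R^2_{\mathrm{med}}$ be the coefficient on $X$, the coefficients on $W_1$ and the R-squared of the regression of $Y$ on $(1,X,W_1)$; let $\beta_{\mathrm{long}}$, $\gamma_{1,\mathrm{long}}$, $\gamma_{2,\mathrm{long}}$, $R^2_{\mathrm{long}}$ be the coefficients on $X$, $W_1$, $W_2$ and the R-squared of the regression of $Y$ on $(1,X,W_1,W_2)$. Let $\pi_1$ be the coefficients on $W_1$ in the regression of $X$ on $(1,W_1)$ and $X^{\perp W_1}=X-\pi_1'W_1$. Consider the following assumptions, for given $\delta\in\mathbb R$ and $M\ge 0$: - A1: $\operatorname{var}(Y,X,W_1,W_2)$ is finite; $\operatorname{var}(X,W_1,W_2)$ and $\operatorname{var}(Y,X,W_1)$ are positive definite. - A2: $\displaystyle \delta\cdot\frac{\operatorname{cov}(X,\gamma_{1,\mathrm{long}}'W_1)}{\operatorname{var}(\gamma_{1,\mathrm{long}}'W_1)}=\frac{\operatorname{cov}(X,\gamma_{2,\mathrm{long}}W_2)}{\operatorname{var}(\gamma_{2,\mathrm{long}}W_2)}$.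 - A3: $\gamma_{1,\mathrm{long}}\ne 0$ and $\gamma_{2,\mathrm{long}}\neq 0$. - A4: $\operatorname{cov}(W_1,W_2)=0$. - A5: $\operatorname{var}(W_2)=1$. - A6: $|\beta_{\mathrm{long}}-\beta_{\mathrm{med}}|\le M$. Suppose that the joint distribution of $(Y,X,W_1)$ is known, with finite and positive definite $\operatorname{var}(Y,X,W_1)$, and that $\delta\in\mathbb R$, $M\ge0$ and $R^2\in(R^2_{\mathrm{med}},1]$ are known. The identified set for $\beta_{\mathrm{long}}$ is the set of all values that $\beta_{\mathrm{long}}$ takes over the joint distributions of $(Y,X,W_1,W_2)$ that have the given marginal distribution of $(Y,X,W_1)$, satisfy A1--A6, and have $R^2_{\mathrm{long}}=R^2$. Then the identified set equals $$\mathcal B_I(\delta,R^2)\cap[\beta_{\mathrm{med}}-M,\ \beta_{\mathrm{med}}+M],$$ where $$\mathcal B_I(\delta,R^2)=\{b\in\mathbb R: f_0(\beta_{\mathrm{med}}-b)+\delta f_1(\beta_{\mathrm{med}}-b,R^2)=0\}\setminus\{b\in\mathbb R:\gamma_{1,\mathrm{med}}+(\beta_{\mathrm{med}}-b)\pi_1=0\},$$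 $$f_0(B)=-B\operatorname{var}(X^{\perp W_1})\left(\operatorname{var}(\gamma_{1,\mathrm{med}}'W_1)+2B\operatorname{cov}(X,\gamma_{1,\mathrm{med}}'W_1)+B^2\operatorname{var}(\pi_1'W_1)\right),$$ $$\begin{aligned}f_1(B,R^2)={}&(R^2-R^2_{\mathrm{med}})\operatorname{var}(Y)\operatorname{cov}(X,\gamma_{1,\mathrm{med}}'W_1)+B(R^2-R^2_{\mathrm{med}})\operatorname{var}(Y)\operatorname{var}(\pi_1'W_1)\\&+B^2\operatorname{var}(X^{\perp W_1})\operatorname{cov}(X,\gamma_{1,\mathrm{med}}'W_1)+B^3\operatorname{var}(X^{\perp W_1})\operatorname{var}(\pi_1'W_1).\end{aligned}$$ -/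

import Mathlib

open MeasureTheory ProbabilityTheory

noncomputable section

namespace OmittedVariable

section Regression

variable {Ω ι : Type*} [MeasurableSpace Ω] [Fintype ι] [DecidableEq ι]

/-- The variance-covariance matrix of the random vector with components `Z i`. -/
def varMatrix (μ : Measure Ω) (Z : ι → Ω → ℝ) : Matrix ι ι ℝ :=
  Matrix.of fun i j => cov[Z i, Z j; μ]

/-- The linear index `c' Z`. -/
def index (c : ι → ℝ) (Z : ι → Ω → ℝ) : Ω → ℝ := fun ω => ∑ i, c i * Z i ω

/-- The population coefficients on `Z` in the OLS regression of the scalar `A` on `(1, Z)`: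
`var(Z)⁻¹ cov(Z, A)`. -/
def olsCoef (μ : Measure Ω) (A : Ω → ℝ) (Z : ι → Ω → ℝ) : ι → ℝ :=
  Matrix.mulVec (varMatrix μ Z)⁻¹ (fun i => cov[Z i, A; μ])

/-- The population R-squared of the OLS regression of `A` on `(1, Z)`: the share of the variance
of `A` that is accounted for by the fitted value. -/
def rSquared (μ : Measure Ω) (A : Ω → ℝ) (Z : ι → Ω → ℝ) : ℝ :=
  Var[index (olsCoef μ A Z) Z; μ] / Var[A; μ]

end Regression

section Setup

variable {Ω : Type*} [MeasurableSpace Ω] {d : ℕ}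

/-- The vector `(X, W₁)`. -/
def medVec (X : Ω → ℝ) (W₁ : Fin d → Ω → ℝ) : Unit ⊕ Fin d → Ω → ℝ :=
  Sum.elim (fun _ => X) W₁

/-- The vector `(X, W₁, W₂)`. -/
def longVec (X : Ω → ℝ) (W₁ : Fin d → Ω → ℝ) (W₂ : Ω → ℝ) : (Unit ⊕ Fin d) ⊕ Unit → Ω → ℝ :=
  Sum.elim (medVec X W₁) (fun _ => W₂)

/-- The vector `(Y, X, W₁)` of observed variables. -/
def obsVec (Y X : Ω → ℝ) (W₁ : Fin d → Ω → ℝ) : Unit ⊕ (Unit ⊕ Fin d) → Ω → ℝ :=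
  Sum.elim (fun _ => Y) (medVec X W₁)

/-- The coefficient on `X` in the medium regression of `Y` on `(1, X, W₁)`. -/
def betaMed (μ : Measure Ω) (Y X : Ω → ℝ) (W₁ : Fin d → Ω → ℝ) : ℝ :=
  olsCoef μ Y (medVec X W₁) (Sum.inl ())

/-- The coefficients on `W₁` in the medium regression. -/
def gammaMed (μ : Measure Ω) (Y X : Ω → ℝ) (W₁ : Fin d → Ω → ℝ) : Fin d → ℝ :=
  fun j => olsCoef μ Y (medVec X W₁) (Sum.inr j)

/-- The R-squared of the medium regression. -/
def rSqMed (μ : Measure Ω) (Y X : Ω → ℝ) (W₁ : Fin d → Ω → ℝ) : ℝ :=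
  rSquared μ Y (medVec X W₁)

/-- The coefficient on `X` in the long regression of `Y` on `(1, X, W₁, W₂)`. -/
def betaLong (μ : Measure Ω) (Y X : Ω → ℝ) (W₁ : Fin d → Ω → ℝ) (W₂ : Ω → ℝ) : ℝ :=
  olsCoef μ Y (longVec X W₁ W₂) (Sum.inl (Sum.inl ()))

/-- The coefficients on `W₁` in the long regression. -/
def gammaLong₁ (μ : Measure Ω) (Y X : Ω → ℝ) (W₁ : Fin d → Ω → ℝ) (W₂ : Ω → ℝ) : Fin d → ℝ :=
  fun j => olsCoef μ Y (longVec X W₁ W₂) (Sum.inl (Sum.inr j))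

/-- The coefficient on the scalar `W₂` in the long regression. -/
def gammaLong₂ (μ : Measure Ω) (Y X : Ω → ℝ) (W₁ : Fin d → Ω → ℝ) (W₂ : Ω → ℝ) : ℝ :=
  olsCoef μ Y (longVec X W₁ W₂) (Sum.inr ())

/-- The R-squared of the long regression. -/
def rSqLong (μ : Measure Ω) (Y X : Ω → ℝ) (W₁ : Fin d → Ω → ℝ) (W₂ : Ω → ℝ) : ℝ :=
  rSquared μ Y (longVec X W₁ W₂)

/-- The coefficients on `W₁` in the regression of `X` on `(1, W₁)`. -/
def piOne (μ : Measure Ω) (X : Ω → ℝ) (W₁ : Fin d → Ω → ℝ) : Fin d → ℝ :=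
  olsCoef μ X W₁

/-- `X - π₁' W₁`. -/
def xPerp (μ : Measure Ω) (X : Ω → ℝ) (W₁ : Fin d → Ω → ℝ) : Ω → ℝ :=
  fun ω => X ω - index (piOne μ X W₁) W₁ ω

/-- The observed part of the moment assumption: `var(Y, X, W₁)` is finite and positive definite. -/
structure ObservedMoments (μ : Measure Ω) (Y X : Ω → ℝ) (W₁ : Fin d → Ω → ℝ) : Prop where
  memLp : ∀ i, MemLp (obsVec Y X W₁ i) 2 μ
  posDef : (varMatrix μ (obsVec Y X W₁)).PosDef

/-- Moment assumption: `var(Y, X, W₁, W₂)` is finite, and `var(X, W₁, W₂)` and `var(Y, X, W₁)` are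
positive definite. -/
structure Moments (μ : Measure Ω) (Y X : Ω → ℝ) (W₁ : Fin d → Ω → ℝ) (W₂ : Ω → ℝ) : Prop where
  observed : ObservedMoments μ Y X W₁
  memLp : MemLp W₂ 2 μ
  posDef : (varMatrix μ (longVec X W₁ W₂)).PosDef

/-- Selection on unobservables is `δ` times selection on observables. -/
def SelectionRatio (μ : Measure Ω) (Y X : Ω → ℝ) (W₁ : Fin d → Ω → ℝ) (W₂ : Ω → ℝ)
    (δ : ℝ) : Prop :=
  δ * (cov[X, index (gammaLong₁ μ Y X W₁ W₂) W₁; μ] / Var[index (gammaLong₁ μ Y X W₁ W₂) W₁; μ])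
    = cov[X, fun ω => gammaLong₂ μ Y X W₁ W₂ * W₂ ω; μ]
        / Var[fun ω => gammaLong₂ μ Y X W₁ W₂ * W₂ ω; μ]

/-- The long coefficients on `W₁` and on `W₂` are nonzero. -/
def NonzeroIndices (μ : Measure Ω) (Y X : Ω → ℝ) (W₁ : Fin d → Ω → ℝ) (W₂ : Ω → ℝ) : Prop :=
  gammaLong₁ μ Y X W₁ W₂ ≠ 0 ∧ gammaLong₂ μ Y X W₁ W₂ ≠ 0

/-- Exogenous controls, `cov(W₁, W₂) = 0`. -/
def ExogenousControls (μ : Measure Ω) (W₁ : Fin d → Ω → ℝ) (W₂ : Ω → ℝ) : Prop :=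
  ∀ j, cov[W₁ j, W₂; μ] = 0

/-- The normalization `var(W₂) = 1`. -/
def Normalization (μ : Measure Ω) (W₂ : Ω → ℝ) : Prop := Var[W₂; μ] = 1

/-- The omitted variable bias is at most `M` in magnitude. -/
def MagnitudeRestriction (μ : Measure Ω) (Y X : Ω → ℝ) (W₁ : Fin d → Ω → ℝ) (W₂ : Ω → ℝ)
    (M : ℝ) : Prop :=
  |betaLong μ Y X W₁ W₂ - betaMed μ Y X W₁| ≤ M

/-- `f₀(B)`. -/
def f₀ (μ : Measure Ω) (Y X : Ω → ℝ) (W₁ : Fin d → Ω → ℝ) (B : ℝ) : ℝ :=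
  -B * Var[xPerp μ X W₁; μ] *
    (Var[index (gammaMed μ Y X W₁) W₁; μ] + 2 * B * cov[X, index (gammaMed μ Y X W₁) W₁; μ]
      + B ^ 2 * Var[index (piOne μ X W₁) W₁; μ])

/-- `f₁(B, R)`, where `R` is the long R-squared. -/
def f₁ (μ : Measure Ω) (Y X : Ω → ℝ) (W₁ : Fin d → Ω → ℝ) (B R : ℝ) : ℝ :=
  (R - rSqMed μ Y X W₁) * Var[Y; μ] * cov[X, index (gammaMed μ Y X W₁) W₁; μ]
    + B * (R - rSqMed μ Y X W₁) * Var[Y; μ] * Var[index (piOne μ X W₁) W₁; μ]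
    + B ^ 2 * Var[xPerp μ X W₁; μ] * cov[X, index (gammaMed μ Y X W₁) W₁; μ]
    + B ^ 3 * Var[xPerp μ X W₁; μ] * Var[index (piOne μ X W₁) W₁; μ]

/-- `f(B, δ, R) = f₀(B) + δ f₁(B, R)`. -/
def f (μ : Measure Ω) (Y X : Ω → ℝ) (W₁ : Fin d → Ω → ℝ) (B δ R : ℝ) : ℝ :=
  f₀ μ Y X W₁ B + δ * f₁ μ Y X W₁ B R

/-- The values `b` that would make the long coefficients on `W₁` vanish. -/
def nonzeroFailSet (μ : Measure Ω) (Y X : Ω → ℝ) (W₁ : Fin d → Ω → ℝ) : Set ℝ :=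
  {b | gammaMed μ Y X W₁ + (betaMed μ Y X W₁ - b) • piOne μ X W₁ = 0}

/-- The set `B_I(δ, R)`. -/
def cubicSet (μ : Measure Ω) (Y X : Ω → ℝ) (W₁ : Fin d → Ω → ℝ) (δ R : ℝ) : Set ℝ :=
  {b | f μ Y X W₁ (betaMed μ Y X W₁ - b) δ R = 0} \ nonzeroFailSet μ Y X W₁

end Setup

section IdentifiedSet

/-- The space of values of the observed `(Y, X, W₁)`. -/
abbrev Obs (d : ℕ) : Type := ℝ × ℝ × (Fin d → ℝ)

/-- The space of values of `((Y, X, W₁), W₂)`. -/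
abbrev Full (d : ℕ) : Type := Obs d × ℝ

variable {d : ℕ}

/-- The coordinate `Y` on `Obs d`. -/
def obsY : Obs d → ℝ := fun p => p.1
/-- The coordinate `X` on `Obs d`. -/
def obsX : Obs d → ℝ := fun p => p.2.1
/-- The coordinates `W₁` on `Obs d`. -/
def obsW : Fin d → Obs d → ℝ := fun j p => p.2.2 j
/-- The coordinate `Y` on `Full d`. -/
def fullY : Full d → ℝ := fun p => obsY p.1
/-- The coordinate `X` on `Full d`. -/
def fullX : Full d → ℝ := fun p => obsX p.1
/-- The coordinates `W₁` on `Full d`. -/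
def fullW : Fin d → Full d → ℝ := fun j p => obsW j p.1
/-- The unobserved coordinate `W₂` on `Full d`. -/
def fullU : Full d → ℝ := fun p => p.2

/-- The identified set for the long coefficient on `X` when the law `P` of `(Y, X, W₁)`, the
selection ratio `δ`, the long R-squared `R` and the bias bound `M` are known: the values that the
coefficient takes over all joint laws `Q` of `(Y, X, W₁, W₂)` which have observed marginal `P`,
satisfy the six assumptions above and have long R-squared `R`. -/
def identifiedSet (P : Measure (Obs d)) (δ R M : ℝ) : Set ℝ :=
  {b | ∃ Q : Measure (Full d), IsProbabilityMeasure Q ∧ Q.map Prod.fst = P ∧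
    Moments Q fullY fullX fullW fullU ∧
    SelectionRatio Q fullY fullX fullW fullU δ ∧
    NonzeroIndices Q fullY fullX fullW fullU ∧
    ExogenousControls Q fullW fullU ∧
    Normalization Q fullU ∧
    MagnitudeRestriction Q fullY fullX fullW fullU M ∧
    rSqLong Q fullY fullX fullW fullU = R ∧
    betaLong Q fullY fullX fullW fullU = b}

end IdentifiedSet

end OmittedVariable

end

/-! Write B = β_med − β_long and v = var(X^{⊥W₁}). For exogenous W₂ of unit variance, the normal
equations give γ₁,long = γ₁,med + Bπ₁ (`Moments.gammaLong₁_eq`), γ₂,long cov(X, W₂) = Bv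
(`Moments.gammaLong₂_mul_cov`) and γ₂,long² = (R²_long − R²_med) var(Y) + B²v
(`Moments.gammaLong₂_sq`). Substituted into the selection ratio and cleared of denominators, these
turn A2 into f₀(B) + δ f₁(B, R²) = 0. Since R²_long > R²_med forces γ₂,long ≠ 0, only γ₁,long ≠ 0
remains of A3; this is `Moments.selection_iff_mem_cubicSet`.

Sharpness needs a joint law for every admissible b. The same identities prescribe the covariances of
W₂ with Y, X and W₁. `ObservedMoments.exists_predictor` realises them by a linear index L of the
observables, with var(L) ≤ 1 because R² ≤ 1, and `exists_extension` adds independent Gaussian noise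
to bring the variance to one. The strict inequality R² > R²_med keeps var(X, W₁, W₂) positive
definite, and `Moments.olsCoef_long_eq` confirms that the long coefficient on X is b. -/

namespace OmittedVariable

/-! ### Normal equations of population least squares. -/

section Ols

variable {Ω ι : Type*} [MeasurableSpace Ω] [Fintype ι]
  {μ : Measure Ω} [IsProbabilityMeasure μ] {Z : ι → Ω → ℝ} {A : Ω → ℝ}

omit [IsProbabilityMeasure μ] in
lemma memLp_index (hZ : ∀ i, MemLp (Z i) 2 μ) (c : ι → ℝ) : MemLp (index c Z) 2 μ := by
  unfold index
  exact memLp_finsetSum _ fun i _ => (hZ i).const_mul (c i)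

lemma cov_index_left (hZ : ∀ i, MemLp (Z i) 2 μ) (hA : MemLp A 2 μ) (c : ι → ℝ) :
    cov[index c Z, A; μ] = ∑ i, c i * cov[Z i, A; μ] := by
  unfold index
  rw [covariance_fun_sum_left (fun i => (hZ i).const_mul (c i)) hA]
  simp_rw [covariance_const_mul_left]

lemma cov_index_right (hZ : ∀ i, MemLp (Z i) 2 μ) (hA : MemLp A 2 μ) (c : ι → ℝ) :
    cov[A, index c Z; μ] = ∑ i, c i * cov[A, Z i; μ] := by
  rw [covariance_comm, cov_index_left hZ hA]
  simp_rw [covariance_comm A]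

lemma varMatrix_mulVec (hZ : ∀ i, MemLp (Z i) 2 μ) (c : ι → ℝ) (i : ι) :
    (varMatrix μ Z).mulVec c i = cov[Z i, index c Z; μ] := by
  rw [cov_index_right hZ (hZ i)]
  simp [Matrix.mulVec, dotProduct, varMatrix, mul_comm]

lemma dotProduct_varMatrix_mulVec (hZ : ∀ i, MemLp (Z i) 2 μ) (c : ι → ℝ) :
    star c ⬝ᵥ (varMatrix μ Z).mulVec c = Var[index c Z; μ] := by
  rw [← covariance_self (memLp_index hZ c).aemeasurable, cov_index_left hZ (memLp_index hZ c)]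
  simp [dotProduct, varMatrix_mulVec hZ]

/-- The quadratic form of the variance matrix at `c` is the variance of the index `c' Z`. -/
lemma posDef_varMatrix_iff (hZ : ∀ i, MemLp (Z i) 2 μ) :
    (varMatrix μ Z).PosDef ↔ ∀ c, c ≠ 0 → 0 < Var[index c Z; μ] := by
  constructor
  · intro h c hc
    rw [← dotProduct_varMatrix_mulVec hZ]
    exact h.dotProduct_mulVec_pos hc
  · intro h
    refine Matrix.PosDef.of_dotProduct_mulVec_pos ?_ fun c hc => ?_
    · ext i j
      simp [varMatrix, covariance_comm]
    · rw [dotProduct_varMatrix_mulVec hZ]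
      exact h c hc

variable [DecidableEq ι]

lemma cov_index_olsCoef (hZ : ∀ i, MemLp (Z i) 2 μ) (h : (varMatrix μ Z).PosDef) (i : ι) :
    cov[Z i, index (olsCoef μ A Z) Z; μ] = cov[Z i, A; μ] := by
  rw [← varMatrix_mulVec hZ, olsCoef, Matrix.mulVec_mulVec,
    Matrix.mul_nonsing_inv _ ((Matrix.isUnit_iff_isUnit_det _).mp h.isUnit), Matrix.one_mulVec]

/-- Positive definiteness leaves one solution of the normal equations, so coefficients can be
identified by checking covariances instead of computing an inverse. -/
lemma olsCoef_eq_of_normal (hZ : ∀ i, MemLp (Z i) 2 μ) (h : (varMatrix μ Z).PosDef)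
    {c : ι → ℝ} (hc : ∀ i, cov[Z i, A; μ] = cov[Z i, index c Z; μ]) : olsCoef μ A Z = c := by
  have : (fun i => cov[Z i, A; μ]) = (varMatrix μ Z).mulVec c := by
    ext i
    rw [varMatrix_mulVec hZ, hc]
  rw [olsCoef, this, Matrix.mulVec_mulVec,
    Matrix.nonsing_inv_mul _ ((Matrix.isUnit_iff_isUnit_det _).mp h.isUnit), Matrix.one_mulVec]

/-- The residual is uncorrelated with the fitted value, so the variance of the fit is its covariance
with `A`. -/
lemma rSquared_mul_variance (hZ : ∀ i, MemLp (Z i) 2 μ) (hA : MemLp A 2 μ)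
    (h : (varMatrix μ Z).PosDef) (hV : Var[A; μ] ≠ 0) :
    rSquared μ A Z * Var[A; μ] = cov[index (olsCoef μ A Z) Z, A; μ] := by
  rw [rSquared, div_mul_cancel₀ _ hV,
    ← covariance_self (memLp_index hZ _).aemeasurable, cov_index_left hZ (memLp_index hZ _),
    cov_index_left hZ hA]
  simp_rw [cov_index_olsCoef hZ h]

end Ols

/-! ### Indices as linear combinations, and their moments. -/

section Affine

variable {Ω : Type*} [MeasurableSpace Ω] {d : ℕ}

omit [MeasurableSpace Ω] in
lemma index_medVec (X : Ω → ℝ) (W : Fin d → Ω → ℝ) (c : Unit ⊕ Fin d → ℝ) :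
    index c (medVec X W) = fun ω => c (Sum.inl ()) * X ω + index (fun j => c (Sum.inr j)) W ω := by
  ext ω
  simp [index, medVec]

omit [MeasurableSpace Ω] in
lemma index_longVec (X : Ω → ℝ) (W : Fin d → Ω → ℝ) (U : Ω → ℝ)
    (c : (Unit ⊕ Fin d) ⊕ Unit → ℝ) :
    index c (longVec X W U) =
      fun ω => index (fun j => c (Sum.inl j)) (medVec X W) ω + c (Sum.inr ()) * U ω := by
  ext ω
  simp [index, longVec]

omit [MeasurableSpace Ω] in
lemma index_obsVec (Y X : Ω → ℝ) (W : Fin d → Ω → ℝ) (c : Unit ⊕ (Unit ⊕ Fin d) → ℝ) :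
    index c (obsVec Y X W) =
      fun ω => c (Sum.inl ()) * Y ω + index (fun j => c (Sum.inr j)) (medVec X W) ω := by
  ext ω
  simp [index, obsVec]

omit [MeasurableSpace Ω] in
lemma index_add_smul {ι : Type*} [Fintype ι] (g p : ι → ℝ) (B : ℝ) (Z : ι → Ω → ℝ) :
    index (g + B • p) Z = fun ω => index g Z ω + B * index p Z ω := by
  ext ω
  simp [index, add_mul, Finset.sum_add_distrib, Finset.mul_sum, mul_assoc]

variable {μ : Measure Ω} [IsProbabilityMeasure μ]

lemma cov_lin_right {A B C : Ω → ℝ} (hA : MemLp A 2 μ) (hB : MemLp B 2 μ) (hC : MemLp C 2 μ)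
    (a b : ℝ) :
    cov[C, fun ω => a * A ω + b * B ω; μ] = a * cov[C, A; μ] + b * cov[C, B; μ] := by
  rw [← covariance_const_mul_right, ← covariance_const_mul_right]
  exact covariance_add_right hC (hA.const_mul a) (hB.const_mul b)

lemma variance_lin {A B : Ω → ℝ} (hA : MemLp A 2 μ) (hB : MemLp B 2 μ) (a b : ℝ) :
    Var[fun ω => a * A ω + b * B ω; μ] =
      a ^ 2 * Var[A; μ] + 2 * a * b * cov[A, B; μ] + b ^ 2 * Var[B; μ] := by
  have := variance_add (hA.const_mul a) (hB.const_mul b)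
  rw [covariance_const_mul_left, covariance_const_mul_right, variance_const_mul,
    variance_const_mul] at this
  calc _ = _ := this
    _ = _ := by ring

end Affine

/-! ### Moments of the observed variables and the medium regression. -/

namespace ObservedMoments

variable {Ω : Type*} [MeasurableSpace Ω] {d : ℕ} {μ : Measure Ω} [IsProbabilityMeasure μ]
  {Y X : Ω → ℝ} {W : Fin d → Ω → ℝ}

omit [IsProbabilityMeasure μ] in
lemma memLp_y (h : ObservedMoments μ Y X W) : MemLp Y 2 μ := h.memLp (Sum.inl ())
omit [IsProbabilityMeasure μ] in
lemma memLp_x (h : ObservedMoments μ Y X W) : MemLp X 2 μ := h.memLp (Sum.inr (Sum.inl ()))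
omit [IsProbabilityMeasure μ] in
lemma memLp_w (h : ObservedMoments μ Y X W) (j : Fin d) : MemLp (W j) 2 μ :=
  h.memLp (Sum.inr (Sum.inr j))
omit [IsProbabilityMeasure μ] in
lemma memLp_med (h : ObservedMoments μ Y X W) (i) : MemLp (medVec X W i) 2 μ :=
  h.memLp (Sum.inr i)

/-- The common source of the positivity facts: particular coefficients yield those for Y, for
indices of W₁, for X^{⊥W₁} and for (X, W₁). -/
lemma variance_lin_pos (h : ObservedMoments μ Y X W) {a b : ℝ} {c : Fin d → ℝ}
    (hc : a ≠ 0 ∨ b ≠ 0 ∨ c ≠ 0) :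
    0 < Var[fun ω => a * Y ω + (b * X ω + index c W ω); μ] := by
  have := (posDef_varMatrix_iff h.memLp).mp h.posDef
    (Sum.elim (fun _ => a) (Sum.elim (fun _ => b) c)) ?_
  · simpa [index_obsVec, index_medVec] using this
  · intro h0
    have ha : a = 0 := congrFun h0 (Sum.inl ())
    have hb : b = 0 := congrFun h0 (Sum.inr (Sum.inl ()))
    have hc' : c = 0 := funext fun j => congrFun h0 (Sum.inr (Sum.inr j))
    simp_all

lemma posDef_med (h : ObservedMoments μ Y X W) : (varMatrix μ (medVec X W)).PosDef := by
  rw [posDef_varMatrix_iff h.memLp_med]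
  intro c hc
  have := h.variance_lin_pos (a := 0) (b := c (Sum.inl ())) (c := fun j => c (Sum.inr j)) ?_
  · simpa [index_medVec] using this
  · by_contra! h0
    refine hc (funext ?_)
    rintro (i | j)
    · exact h0.2.1
    · exact congrFun h0.2.2 j

lemma variance_index_pos (h : ObservedMoments μ Y X W) {c : Fin d → ℝ} (hc : c ≠ 0) :
    0 < Var[index c W; μ] := by
  simpa using h.variance_lin_pos (a := 0) (b := 0) (Or.inr (Or.inr hc))

lemma posDef_w (h : ObservedMoments μ Y X W) : (varMatrix μ W).PosDef :=
  (posDef_varMatrix_iff h.memLp_w).mpr fun _ hc => h.variance_index_pos hc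

lemma variance_y_pos (h : ObservedMoments μ Y X W) : 0 < Var[Y; μ] := by
  simpa [index] using h.variance_lin_pos (a := 1) (b := 0) (c := 0) (Or.inl one_ne_zero)

lemma variance_xPerp_pos (h : ObservedMoments μ Y X W) : 0 < Var[xPerp μ X W; μ] := by
  have := h.variance_lin_pos (a := 0) (b := 1) (c := -piOne μ X W) (Or.inr (Or.inl one_ne_zero))
  have e : xPerp μ X W = fun ω => 0 * Y ω + (1 * X ω + index (-piOne μ X W) W ω) := by
    ext ω
    simp [xPerp, index, sub_eq_add_neg]
  rwa [e]

omit [IsProbabilityMeasure μ] in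
lemma memLp_index (h : ObservedMoments μ Y X W) (c : Fin d → ℝ) : MemLp (index c W) 2 μ :=
  OmittedVariable.memLp_index h.memLp_w c

/-- Projecting `X` on `W₁` preserves covariances with linear indices of `W₁`. -/
lemma cov_index_x (h : ObservedMoments μ Y X W) (c : Fin d → ℝ) :
    cov[X, index c W; μ] = cov[index c W, index (piOne μ X W) W; μ] := by
  rw [covariance_comm, cov_index_left h.memLp_w h.memLp_x,
    cov_index_left h.memLp_w (h.memLp_index _)]
  simp_rw [piOne, cov_index_olsCoef h.memLp_w h.posDef_w]

lemma cov_x_index_pi (h : ObservedMoments μ Y X W) :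
    cov[X, index (piOne μ X W) W; μ] = Var[index (piOne μ X W) W; μ] := by
  rw [h.cov_index_x, covariance_self (h.memLp_index _).aemeasurable]

lemma variance_xPerp (h : ObservedMoments μ Y X W) :
    Var[xPerp μ X W; μ] = Var[X; μ] - Var[index (piOne μ X W) W; μ] := by
  unfold xPerp
  rw [variance_fun_sub h.memLp_x (h.memLp_index _), h.cov_x_index_pi]
  ring

omit [IsProbabilityMeasure μ] in
lemma index_olsCoef_med :
    index (olsCoef μ Y (medVec X W)) (medVec X W) =
      fun ω => betaMed μ Y X W * X ω + 1 * index (gammaMed μ Y X W) W ω := by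
  rw [index_medVec]
  simp only [one_mul]
  rfl

lemma cov_x_y (h : ObservedMoments μ Y X W) :
    cov[X, Y; μ] = betaMed μ Y X W * Var[X; μ] + cov[X, index (gammaMed μ Y X W) W; μ] := by
  have := cov_index_olsCoef (A := Y) h.memLp_med h.posDef_med (Sum.inl ())
  rw [index_olsCoef_med, cov_lin_right h.memLp_x (h.memLp_index _) (h.memLp_med _), one_mul] at this
  rw [← covariance_self h.memLp_x.aemeasurable]
  exact this.symm

lemma cov_w_y (h : ObservedMoments μ Y X W) (j : Fin d) :
    cov[W j, Y; μ] =
      betaMed μ Y X W * cov[W j, X; μ] + cov[W j, index (gammaMed μ Y X W) W; μ] := by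
  have := cov_index_olsCoef (A := Y) h.memLp_med h.posDef_med (Sum.inr j)
  rw [index_olsCoef_med, cov_lin_right h.memLp_x (h.memLp_index _) (h.memLp_med _), one_mul] at this
  exact this.symm

lemma cov_index_y (h : ObservedMoments μ Y X W) (c : Fin d → ℝ) :
    cov[index c W, Y; μ] =
      betaMed μ Y X W * cov[X, index c W; μ]
        + cov[index c W, index (gammaMed μ Y X W) W; μ] := by
  rw [covariance_comm X, cov_index_left h.memLp_w h.memLp_y, cov_index_left h.memLp_w h.memLp_x,
    cov_index_left h.memLp_w (h.memLp_index _), Finset.mul_sum, ← Finset.sum_add_distrib]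
  refine Finset.sum_congr rfl fun j _ => ?_
  rw [h.cov_w_y]
  ring

lemma rSqMed_mul_variance (h : ObservedMoments μ Y X W) :
    rSqMed μ Y X W * Var[Y; μ] =
      betaMed μ Y X W * cov[X, Y; μ] + cov[index (gammaMed μ Y X W) W, Y; μ] := by
  rw [rSqMed, rSquared_mul_variance h.memLp_med h.memLp_y h.posDef_med h.variance_y_pos.ne',
    index_olsCoef_med, covariance_comm, cov_lin_right h.memLp_x (h.memLp_index _) h.memLp_y,
    covariance_comm Y, covariance_comm Y, one_mul]

end ObservedMoments

end OmittedVariable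

namespace OmittedVariable

/-! ### The long regression and the omitted variable formulas. -/

namespace Moments

variable {Ω : Type*} [MeasurableSpace Ω] {d : ℕ} {μ : Measure Ω} [IsProbabilityMeasure μ]
  {Y X U : Ω → ℝ} {W : Fin d → Ω → ℝ}

omit [IsProbabilityMeasure μ] in
lemma memLp_long (h : Moments μ Y X W U) (i) : MemLp (longVec X W U i) 2 μ := by
  rcases i with i | i
  · exact h.observed.memLp_med i
  · exact h.memLp

lemma cov_index_longVec (h : Moments μ Y X W U) {A : Ω → ℝ} (hA : MemLp A 2 μ)
    (c : (Unit ⊕ Fin d) ⊕ Unit → ℝ) :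
    cov[A, index c (longVec X W U); μ] =
      c (Sum.inl (Sum.inl ())) * cov[A, X; μ]
        + cov[A, index (fun j => c (Sum.inl (Sum.inr j))) W; μ] + c (Sum.inr ()) * cov[A, U; μ] := by
  rw [index_longVec, index_medVec]
  have h1 := cov_lin_right h.observed.memLp_x
    (h.observed.memLp_index fun j => c (Sum.inl (Sum.inr j))) hA (c (Sum.inl (Sum.inl ()))) 1
  have h2 := cov_lin_right ((h.observed.memLp_x.const_mul (c (Sum.inl (Sum.inl ())))).add
    (h.observed.memLp_index fun j => c (Sum.inl (Sum.inr j)))) h.memLp hA 1 (c (Sum.inr ()))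
  simp only [Pi.add_apply, one_mul] at h1 h2
  rw [h2, ← h1]
  rfl

lemma cov_long_y (h : Moments μ Y X W U) (i) :
    cov[longVec X W U i, Y; μ] =
      betaLong μ Y X W U * cov[longVec X W U i, X; μ]
        + cov[longVec X W U i, index (gammaLong₁ μ Y X W U) W; μ]
        + gammaLong₂ μ Y X W U * cov[longVec X W U i, U; μ] := by
  rw [← cov_index_olsCoef h.memLp_long h.posDef, h.cov_index_longVec (h.memLp_long i)]
  rfl

lemma cov_index_u (h : Moments μ Y X W U) (hE : ExogenousControls μ W U) (c : Fin d → ℝ) :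
    cov[U, index c W; μ] = 0 := by
  rw [covariance_comm, cov_index_left h.observed.memLp_w h.memLp]
  exact Finset.sum_eq_zero fun j _ => by rw [hE j, mul_zero]

/-- Both sides are the coefficients in the regression of Y − β_long X on W₁: what remains in the
long regression, γ₂W₂ plus the residual, is uncorrelated with W₁. -/
lemma gammaLong₁_eq (h : Moments μ Y X W U) (hE : ExogenousControls μ W U) :
    gammaLong₁ μ Y X W U =
      gammaMed μ Y X W + (betaMed μ Y X W - betaLong μ Y X W U) • piOne μ X W := by
  have ho := h.observed
  have hA (j : Fin d) := cov_lin_right ho.memLp_y ho.memLp_x (ho.memLp_w j) 1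
    (-betaLong μ Y X W U)
  trans olsCoef μ (fun ω => 1 * Y ω + -betaLong μ Y X W U * X ω) W
  · refine (olsCoef_eq_of_normal ho.memLp_w ho.posDef_w fun j => ?_).symm
    have h1 : cov[W j, Y; μ] = betaLong μ Y X W U * cov[W j, X; μ]
        + cov[W j, index (gammaLong₁ μ Y X W U) W; μ]
        + gammaLong₂ μ Y X W U * cov[W j, U; μ] := h.cov_long_y (Sum.inl (Sum.inr j))
    rw [hA, h1, hE j]
    ring
  · refine olsCoef_eq_of_normal ho.memLp_w ho.posDef_w fun j => ?_
    have h2 := cov_lin_right (ho.memLp_index (gammaMed μ Y X W)) (ho.memLp_index (piOne μ X W))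
      (ho.memLp_w j) 1 (betaMed μ Y X W - betaLong μ Y X W U)
    have h3 : cov[W j, index (piOne μ X W) W; μ] = cov[W j, X; μ] :=
      cov_index_olsCoef ho.memLp_w ho.posDef_w j
    simp only [one_mul] at h2
    rw [hA, index_add_smul, h2, ho.cov_w_y, h3]
    ring

lemma cov_x_index_gamma_add (h : Moments μ Y X W U) (B : ℝ) :
    cov[X, index (gammaMed μ Y X W + B • piOne μ X W) W; μ] =
      cov[X, index (gammaMed μ Y X W) W; μ] + B * Var[index (piOne μ X W) W; μ] := by
  have ho := h.observed
  have := cov_lin_right (ho.memLp_index (gammaMed μ Y X W)) (ho.memLp_index (piOne μ X W))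
    ho.memLp_x 1 B
  rw [ho.cov_x_index_pi] at this
  simpa only [index_add_smul, one_mul] using this

/-- This is the bracket in `f₀`; the cross term involves X because π₁'W₁ is the projection of X on
W₁. -/
lemma variance_index_gamma_add (h : Moments μ Y X W U) (B : ℝ) :
    Var[index (gammaMed μ Y X W + B • piOne μ X W) W; μ] =
      Var[index (gammaMed μ Y X W) W; μ] + 2 * B * cov[X, index (gammaMed μ Y X W) W; μ]
        + B ^ 2 * Var[index (piOne μ X W) W; μ] := by
  have ho := h.observed
  have := variance_lin (ho.memLp_index (gammaMed μ Y X W)) (ho.memLp_index (piOne μ X W)) 1 B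
  rw [← ho.cov_index_x] at this
  simpa [index_add_smul] using this

/-- The omitted variable bias formula. -/
lemma gammaLong₂_mul_cov (h : Moments μ Y X W U) (hE : ExogenousControls μ W U) :
    gammaLong₂ μ Y X W U * cov[X, U; μ] =
      (betaMed μ Y X W - betaLong μ Y X W U) * Var[xPerp μ X W; μ] := by
  have ho := h.observed
  -- Compare the normal equations for X in the long and medium regressions.
  have h1 : cov[X, Y; μ] = betaLong μ Y X W U * cov[X, X; μ]
      + cov[X, index (gammaLong₁ μ Y X W U) W; μ]
      + gammaLong₂ μ Y X W U * cov[X, U; μ] := h.cov_long_y (Sum.inl (Sum.inl ()))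
  rw [h.gammaLong₁_eq hE, h.cov_x_index_gamma_add, ho.cov_x_y,
    covariance_self ho.memLp_x.aemeasurable] at h1
  rw [ho.variance_xPerp]
  linarith

lemma cov_u_y (h : Moments μ Y X W U) (hE : ExogenousControls μ W U) (hN : Normalization μ U) :
    cov[U, Y; μ] = betaLong μ Y X W U * cov[X, U; μ] + gammaLong₂ μ Y X W U := by
  have h1 : cov[U, Y; μ] = betaLong μ Y X W U * cov[U, X; μ]
      + cov[U, index (gammaLong₁ μ Y X W U) W; μ]
      + gammaLong₂ μ Y X W U * cov[U, U; μ] := h.cov_long_y (Sum.inr ())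
  rw [h.cov_index_u hE, covariance_self h.memLp.aemeasurable, hN, covariance_comm U X] at h1
  linarith

/-- Subtract the explained variances of the two regressions, each written as the covariance of the
fit with Y. The normal equation for W₂ produces the square, and the bias formula removes cov(X, W₂).
-/
lemma gammaLong₂_sq (h : Moments μ Y X W U) (hE : ExogenousControls μ W U)
    (hN : Normalization μ U) :
    gammaLong₂ μ Y X W U ^ 2 =
      (rSqLong μ Y X W U - rSqMed μ Y X W) * Var[Y; μ]
        + (betaMed μ Y X W - betaLong μ Y X W U) ^ 2 * Var[xPerp μ X W; μ] := by
  have ho := h.observed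
  have h1 : rSqLong μ Y X W U * Var[Y; μ] = betaLong μ Y X W U * cov[Y, X; μ]
      + cov[Y, index (gammaLong₁ μ Y X W U) W; μ] + gammaLong₂ μ Y X W U * cov[Y, U; μ] := by
    rw [rSqLong, rSquared_mul_variance h.memLp_long ho.memLp_y h.posDef ho.variance_y_pos.ne',
      covariance_comm, h.cov_index_longVec ho.memLp_y]
    rfl
  have h2 := cov_lin_right (ho.memLp_index (gammaMed μ Y X W)) (ho.memLp_index (piOne μ X W))
    ho.memLp_y 1 (betaMed μ Y X W - betaLong μ Y X W U)
  have h3 := ho.rSqMed_mul_variance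
  have h4 := ho.cov_index_y (piOne μ X W)
  rw [ho.cov_x_index_pi, covariance_comm (index (piOne μ X W) W) (index _ _),
    ← ho.cov_index_x] at h4
  simp only [one_mul] at h2
  rw [h.gammaLong₁_eq hE, index_add_smul, h2, covariance_comm Y (index (piOne μ X W) W), h4,
    covariance_comm Y U, h.cov_u_y hE hN, covariance_comm Y X, covariance_comm Y, ho.cov_x_y] at h1
  have h5 := h.gammaLong₂_mul_cov hE
  rw [ho.cov_x_y] at h3
  rw [ho.variance_xPerp] at h5 ⊢
  linear_combination h3 - h1 - betaLong μ Y X W U * h5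

/-- The selection ratio and nonzero-index assumptions hold exactly when the long coefficient is an
admissible root of the cubic. -/
theorem selection_iff_mem_cubicSet (h : Moments μ Y X W U) (hE : ExogenousControls μ W U)
    (hN : Normalization μ U) (hR : rSqMed μ Y X W < rSqLong μ Y X W U) (δ : ℝ) :
    SelectionRatio μ Y X W U δ ∧ NonzeroIndices μ Y X W U ↔
      betaLong μ Y X W U ∈ cubicSet μ Y X W δ (rSqLong μ Y X W U) := by
  have ho := h.observed
  have hsq := h.gammaLong₂_sq hE hN
  -- The strict gain in R-squared makes γ₂,long nonzero, hence also the denominator on the W₂ side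
  -- of the ratio.
  have hpos : 0 < gammaLong₂ μ Y X W U ^ 2 := by
    rw [hsq]
    have h1 := mul_pos (sub_pos.mpr hR) ho.variance_y_pos
    have h2 := ho.variance_xPerp_pos
    positivity
  have hg2 : gammaLong₂ μ Y X W U ≠ 0 := fun h0 => by simp [h0] at hpos
  have key (hne : gammaLong₁ μ Y X W U ≠ 0) : SelectionRatio μ Y X W U δ ↔
      f μ Y X W (betaMed μ Y X W - betaLong μ Y X W U) δ (rSqLong μ Y X W U) = 0 := by
    have hV := ho.variance_index_pos hne
    unfold SelectionRatio
    rw [covariance_const_mul_right, variance_const_mul, hN, h.gammaLong₂_mul_cov hE, mul_one,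
      mul_div_assoc', div_eq_div_iff hV.ne' hpos.ne', h.gammaLong₁_eq hE,
      h.cov_x_index_gamma_add, h.variance_index_gamma_add, hsq, f, f₀, f₁, ← sub_eq_zero]
    refine Eq.congr ?_ rfl
    ring
  have hfail : gammaLong₁ μ Y X W U ≠ 0 ↔ betaLong μ Y X W U ∉ nonzeroFailSet μ Y X W := by
    rw [h.gammaLong₁_eq hE]
    rfl
  constructor
  · rintro ⟨hS, hne, -⟩
    exact ⟨(key hne).mp hS, hfail.mp hne⟩
  · rintro ⟨hf, hne⟩
    exact ⟨(key (hfail.mpr hne)).mpr hf, hfail.mpr hne, hg2⟩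

/-- Long coefficients recovered from the covariances of the omitted variable. -/
lemma olsCoef_long_eq (h : Moments μ Y X W U) (hE : ExogenousControls μ W U)
    (hN : Normalization μ U) {b g : ℝ}
    (hX : g * cov[X, U; μ] = (betaMed μ Y X W - b) * Var[xPerp μ X W; μ])
    (hY : cov[U, Y; μ] = b * cov[X, U; μ] + g) :
    betaLong μ Y X W U = b ∧ gammaLong₂ μ Y X W U = g := by
  have ho := h.observed
  -- The W₁ block of the candidate is the value forced by `gammaLong₁_eq`.
  have : olsCoef μ Y (longVec X W U) =
      Sum.elim (Sum.elim (fun _ => b) (gammaMed μ Y X W + (betaMed μ Y X W - b) • piOne μ X W))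
        (fun _ => g) := by
    refine olsCoef_eq_of_normal h.memLp_long h.posDef fun i => ?_
    rw [h.cov_index_longVec (h.memLp_long i)]
    simp only [Sum.elim_inl, Sum.elim_inr]
    rcases i with (i | j) | i
    · change cov[X, Y; μ] = b * cov[X, X; μ]
        + cov[X, index (gammaMed μ Y X W + (betaMed μ Y X W - b) • piOne μ X W) W; μ]
        + g * cov[X, U; μ]
      rw [hX, h.cov_x_index_gamma_add, ho.cov_x_y, covariance_self ho.memLp_x.aemeasurable,
        ho.variance_xPerp]
      ring
    · change cov[W j, Y; μ] = b * cov[W j, X; μ]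
        + cov[W j, index (gammaMed μ Y X W + (betaMed μ Y X W - b) • piOne μ X W) W; μ]
        + g * cov[W j, U; μ]
      have h2 := cov_lin_right (ho.memLp_index (gammaMed μ Y X W)) (ho.memLp_index (piOne μ X W))
        (ho.memLp_w j) 1 (betaMed μ Y X W - b)
      have h3 : cov[W j, index (piOne μ X W) W; μ] = cov[W j, X; μ] :=
        cov_index_olsCoef ho.memLp_w ho.posDef_w j
      simp only [one_mul] at h2
      rw [index_add_smul, h2, ho.cov_w_y, h3, hE j]
      ring
    · change cov[U, Y; μ] = b * cov[U, X; μ]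
        + cov[U, index (gammaMed μ Y X W + (betaMed μ Y X W - b) • piOne μ X W) W; μ]
        + g * cov[U, U; μ]
      rw [h.cov_index_u hE, hY, covariance_self h.memLp.aemeasurable, hN, covariance_comm U X]
      ring
  exact ⟨congrFun this (Sum.inl (Sum.inl ())), congrFun this (Sum.inr ())⟩

end Moments

/-- An exogenous, normalized omitted variable whose covariance with `X` is small enough keeps the
variance matrix of the long regressors positive definite. -/
lemma ObservedMoments.moments {Ω : Type*} [MeasurableSpace Ω] {d : ℕ} {μ : Measure Ω}
    [IsProbabilityMeasure μ] {Y X U : Ω → ℝ} {W : Fin d → Ω → ℝ}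
    (h : ObservedMoments μ Y X W) (hU : MemLp U 2 μ) (hE : ExogenousControls μ W U)
    (hN : Normalization μ U) (hc : cov[X, U; μ] ^ 2 < Var[xPerp μ X W; μ]) :
    Moments μ Y X W U := by
  have hZ (i) : MemLp (longVec X W U i) 2 μ := by
    rcases i with i | i
    · exact h.memLp_med i
    · exact hU
  refine ⟨h, hU, (posDef_varMatrix_iff hZ).mpr fun c hc0 => ?_⟩
  rw [index_longVec]
  set a := c (Sum.inl (Sum.inl ())) with ha
  set w : Fin d → ℝ := fun j => c (Sum.inl (Sum.inr j)) with hw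
  set u := c (Sum.inr ()) with hu
  have hpi (v : Fin d → ℝ) : cov[U, index v W; μ] = 0 := by
    rw [covariance_comm, cov_index_left h.memLp_w hU]
    exact Finset.sum_eq_zero fun j _ => by rw [hE j, mul_zero]
  have hxp : MemLp (xPerp μ X W) 2 μ := h.memLp_x.sub (h.memLp_index _)
  -- Splitting X into X^{⊥W₁} + π₁'W₁ isolates an index of W₁ uncorrelated with both X^{⊥W₁} and U.
  have e : (fun ω => index (fun j => c (Sum.inl j)) (medVec X W) ω + u * U ω) =
      fun ω => 1 * (a * xPerp μ X W ω + 1 * index (w + a • piOne μ X W) W ω) + u * U ω := by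
    ext ω
    rw [index_medVec, index_add_smul]
    simp only [xPerp]
    ring
  have hcov1 : cov[xPerp μ X W, index (w + a • piOne μ X W) W; μ] = 0 := by
    unfold xPerp
    rw [covariance_fun_sub_left h.memLp_x (h.memLp_index _) (h.memLp_index _), h.cov_index_x,
      covariance_comm, sub_self]
  have hcov2 : cov[U, xPerp μ X W; μ] = cov[X, U; μ] := by
    unfold xPerp
    rw [covariance_fun_sub_right hU h.memLp_x (h.memLp_index _), hpi, sub_zero, covariance_comm]
  rw [e, variance_lin (A := fun ω => a * xPerp μ X W ω + 1 * index (w + a • piOne μ X W) W ω)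
      ((hxp.const_mul a).add ((h.memLp_index _).const_mul 1)) hU,
    variance_lin hxp (h.memLp_index _), covariance_comm _ U,
    cov_lin_right hxp (h.memLp_index _) hU, hcov1, hcov2, hpi, hN]
  have hv := h.variance_xPerp_pos
  have hI := variance_nonneg (index (w + a • piOne μ X W) W) μ
  set v := Var[xPerp μ X W; μ]
  set k := cov[X, U; μ]
  set I := Var[index (w + a • piOne μ X W) W; μ] with hIdef
  -- The variance with the square in `u` completed; `hc` makes the first term positive when `a ≠ 0`.
  have hgoal : 0 < a ^ 2 * (v - k ^ 2) + (a * k + u) ^ 2 + I := by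
    by_cases ha0 : a = 0
    · by_cases hu0 : u = 0
      · have hw0 : w ≠ 0 := by
          rintro hw0
          refine hc0 (funext ?_)
          rintro ((i | j) | i)
          · exact ha0
          · exact congrFun hw0 j
          · exact hu0
        have := h.variance_index_pos hw0
        simpa [hIdef, ha0, hu0] using this
      · have := sq_pos_of_ne_zero hu0
        simp only [ha0, zero_mul, zero_add, ne_eq, OfNat.ofNat_ne_zero, not_false_eq_true,
          zero_pow]
        linarith
    · have : 0 < v - k ^ 2 := sub_pos.mpr hc
      positivity
  linarith

end OmittedVariable

namespace OmittedVariable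

/-! ### Invariance of the regression quantities under push-forward. -/

section Map

variable {Ω Ω' ι : Type*} [MeasurableSpace Ω] [MeasurableSpace Ω'] [Fintype ι] {d : ℕ}
  {μ : Measure Ω'} {T : Ω' → Ω}

lemma cov_map_comp (hT : Measurable T) {A B : Ω → ℝ} (hA : Measurable A) (hB : Measurable B) :
    cov[A, B; μ.map T] = cov[fun ω => A (T ω), fun ω => B (T ω); μ] :=
  covariance_map hA.aestronglyMeasurable hB.aestronglyMeasurable hT.aemeasurable

lemma variance_map_comp (hT : Measurable T) {A : Ω → ℝ} (hA : Measurable A) :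
    Var[A; μ.map T] = Var[fun ω => A (T ω); μ] :=
  variance_map hA.aemeasurable hT.aemeasurable

lemma memLp_map_comp (hT : Measurable T) {A : Ω → ℝ} (hA : Measurable A) :
    MemLp A 2 (μ.map T) ↔ MemLp (fun ω => A (T ω)) 2 μ :=
  memLp_map_measure_iff hA.aestronglyMeasurable hT.aemeasurable

lemma measurable_index {Z : ι → Ω → ℝ} (hZ : ∀ i, Measurable (Z i)) (c : ι → ℝ) :
    Measurable (index c Z) :=
  Finset.measurable_fun_sum _ fun i _ => (hZ i).const_mul (c i)

omit [Fintype ι] in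
lemma varMatrix_map (hT : Measurable T) {Z : ι → Ω → ℝ} (hZ : ∀ i, Measurable (Z i)) :
    varMatrix (μ.map T) Z = varMatrix μ (fun i ω => Z i (T ω)) := by
  ext i j
  exact cov_map_comp hT (hZ i) (hZ j)

variable [DecidableEq ι]

lemma olsCoef_map (hT : Measurable T) {A : Ω → ℝ} (hA : Measurable A) {Z : ι → Ω → ℝ}
    (hZ : ∀ i, Measurable (Z i)) :
    olsCoef (μ.map T) A Z = olsCoef μ (fun ω => A (T ω)) (fun i ω => Z i (T ω)) := by
  simp only [olsCoef, varMatrix_map hT hZ, cov_map_comp hT (hZ _) hA]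

lemma rSquared_map (hT : Measurable T) {A : Ω → ℝ} (hA : Measurable A) {Z : ι → Ω → ℝ}
    (hZ : ∀ i, Measurable (Z i)) :
    rSquared (μ.map T) A Z = rSquared μ (fun ω => A (T ω)) (fun i ω => Z i (T ω)) := by
  simp only [rSquared, olsCoef_map hT hA hZ, variance_map_comp hT (measurable_index hZ _),
    variance_map_comp hT hA]
  rfl

variable {Y X : Ω → ℝ} {W : Fin d → Ω → ℝ}

lemma measurable_medVec (hX : Measurable X) (hW : ∀ j, Measurable (W j)) (i) :
    Measurable (medVec X W i) := by
  rcases i with i | j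
  · exact hX
  · exact hW j

lemma measurable_obsVec (hY : Measurable Y) (hX : Measurable X) (hW : ∀ j, Measurable (W j)) (i) :
    Measurable (obsVec Y X W i) := by
  rcases i with i | i
  · exact hY
  · exact measurable_medVec hX hW i

omit [MeasurableSpace Ω] [MeasurableSpace Ω'] in
lemma medVec_comp (T : Ω' → Ω) (X : Ω → ℝ) (W : Fin d → Ω → ℝ) :
    (fun i ω => medVec X W i (T ω)) = medVec (fun ω => X (T ω)) (fun j ω => W j (T ω)) := by
  ext (i | i) ω <;> rfl

omit [MeasurableSpace Ω] [MeasurableSpace Ω'] in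
lemma obsVec_comp (T : Ω' → Ω) (Y X : Ω → ℝ) (W : Fin d → Ω → ℝ) :
    (fun i ω => obsVec Y X W i (T ω)) =
      obsVec (fun ω => Y (T ω)) (fun ω => X (T ω)) (fun j ω => W j (T ω)) := by
  ext (i | i | i) ω <;> rfl

lemma observedMoments_map (hT : Measurable T) (hY : Measurable Y) (hX : Measurable X)
    (hW : ∀ j, Measurable (W j)) :
    ObservedMoments (μ.map T) Y X W ↔
      ObservedMoments μ (fun ω => Y (T ω)) (fun ω => X (T ω)) (fun j ω => W j (T ω)) := by
  have hV := varMatrix_map (μ := μ) hT (measurable_obsVec hY hX hW)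
  rw [obsVec_comp] at hV
  have hL (i) : MemLp (obsVec Y X W i) 2 (μ.map T) ↔
      MemLp (obsVec (fun ω => Y (T ω)) (fun ω => X (T ω)) (fun j ω => W j (T ω)) i) 2 μ := by
    rw [memLp_map_comp hT (measurable_obsVec hY hX hW i), ← obsVec_comp T Y X W]
  exact ⟨fun h => ⟨fun i => (hL i).mp (h.memLp i), hV ▸ h.posDef⟩,
    fun h => ⟨fun i => (hL i).mpr (h.memLp i), hV ▸ h.posDef⟩⟩

lemma betaMed_map (hT : Measurable T) (hY : Measurable Y) (hX : Measurable X)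
    (hW : ∀ j, Measurable (W j)) :
    betaMed (μ.map T) Y X W =
      betaMed μ (fun ω => Y (T ω)) (fun ω => X (T ω)) (fun j ω => W j (T ω)) := by
  rw [betaMed, olsCoef_map hT hY (measurable_medVec hX hW), medVec_comp, betaMed]

lemma gammaMed_map (hT : Measurable T) (hY : Measurable Y) (hX : Measurable X)
    (hW : ∀ j, Measurable (W j)) :
    gammaMed (μ.map T) Y X W =
      gammaMed μ (fun ω => Y (T ω)) (fun ω => X (T ω)) (fun j ω => W j (T ω)) := by
  unfold gammaMed
  rw [olsCoef_map hT hY (measurable_medVec hX hW), medVec_comp]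

lemma rSqMed_map (hT : Measurable T) (hY : Measurable Y) (hX : Measurable X)
    (hW : ∀ j, Measurable (W j)) :
    rSqMed (μ.map T) Y X W =
      rSqMed μ (fun ω => Y (T ω)) (fun ω => X (T ω)) (fun j ω => W j (T ω)) := by
  rw [rSqMed, rSquared_map hT hY (measurable_medVec hX hW), medVec_comp, rSqMed]

/-- With `T` the projection that forgets W₂, the set defined by the observed law can be computed
under any joint law extending it. -/
lemma cubicSet_map (hT : Measurable T) (hY : Measurable Y) (hX : Measurable X)
    (hW : ∀ j, Measurable (W j)) (δ R : ℝ) :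
    cubicSet (μ.map T) Y X W δ R =
      cubicSet μ (fun ω => Y (T ω)) (fun ω => X (T ω)) (fun j ω => W j (T ω)) δ R := by
  have hp : piOne (μ.map T) X W = piOne μ (fun ω => X (T ω)) (fun j ω => W j (T ω)) :=
    olsCoef_map hT hX hW
  have hi (c : Fin d → ℝ) : Var[index c W; μ.map T] = Var[index c (fun j ω => W j (T ω)); μ] :=
    variance_map_comp hT (measurable_index hW c)
  have hc (c : Fin d → ℝ) : cov[X, index c W; μ.map T] =
      cov[fun ω => X (T ω), index c (fun j ω => W j (T ω)); μ] :=
    cov_map_comp hT hX (measurable_index hW c)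
  have hv : Var[xPerp (μ.map T) X W; μ.map T] =
      Var[xPerp μ (fun ω => X (T ω)) (fun j ω => W j (T ω)); μ] := by
    rw [variance_map_comp (A := xPerp _ X W) hT (hX.sub (measurable_index hW _))]
    simp only [xPerp, hp]
    rfl
  simp only [cubicSet, nonzeroFailSet, f, f₀, f₁, betaMed_map hT hY hX hW,
    gammaMed_map hT hY hX hW, rSqMed_map hT hY hX hW, hp, hi, hc, hv, variance_map_comp hT hY]

end Map

/-! ### Construction of the omitted variable. -/

/-- A law on `Ω` extends to a joint law with a further unit-variance coordinate whose covariances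
with the old coordinates are those of a given `L` of variance at most one. -/
lemma exists_extension {Ω : Type*} [MeasurableSpace Ω] (P : Measure Ω) [IsProbabilityMeasure P]
    {L : Ω → ℝ} (hLm : Measurable L) (hL : MemLp L 2 P) (hV : Var[L; P] ≤ 1) :
    ∃ Q : Measure (Ω × ℝ), IsProbabilityMeasure Q ∧ Q.map Prod.fst = P ∧
      MemLp Prod.snd 2 Q ∧ Var[Prod.snd; Q] = 1 ∧
      ∀ A : Ω → ℝ, Measurable A → MemLp A 2 P →
        cov[fun p => A p.1, Prod.snd; Q] = cov[A, L; P] := by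
  set ν := gaussianReal 0 1
  -- The new coordinate is L + sZ with Z standard normal and independent of the old ones; `s`
  -- supplies the variance missing from L.
  set s := √(1 - Var[L; P])
  have hs : s ^ 2 = 1 - Var[L; P] := Real.sq_sqrt (by linarith)
  have hz : MemLp (fun x : ℝ => x) 2 ν := memLp_id_gaussianReal' 2 (by simp)
  have hz' : MemLp (fun p : Ω × ℝ => p.2) 2 (P.prod ν) := hz.comp_snd P
  have hL' : MemLp (fun p : Ω × ℝ => L p.1) 2 (P.prod ν) := hL.comp_fst ν
  have hfst : (P.prod ν).map Prod.fst = P := by simp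
  have hsnd : (P.prod ν).map Prod.snd = ν := by simp
  have hcross (A : Ω → ℝ) (hA : Measurable A) (hA2 : MemLp A 2 P) :
      cov[fun p : Ω × ℝ => A p.1, fun p => p.2; P.prod ν] = 0 :=
    (indepFun_prod hA measurable_id).covariance_eq_zero (hA2.comp_fst ν) hz'
  have hT : Measurable fun p : Ω × ℝ => (p.1, 1 * L p.1 + s * p.2) := by fun_prop
  refine ⟨(P.prod ν).map fun p => (p.1, 1 * L p.1 + s * p.2),
    Measure.isProbabilityMeasure_map hT.aemeasurable, ?_, ?_, ?_, fun A hA hA2 => ?_⟩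
  · rw [Measure.map_map measurable_fst hT]
    exact hfst
  · rw [memLp_map_comp hT measurable_snd]
    exact (hL'.const_mul 1).add (hz'.const_mul s)
  · have h1 : Var[fun p : Ω × ℝ => L p.1; P.prod ν] = Var[L; P] := by
      rw [← variance_map_comp measurable_fst hLm, hfst]
    have h2 : Var[fun p : Ω × ℝ => p.2; P.prod ν] = 1 := by
      rw [← variance_map_comp (A := fun x => x) measurable_snd measurable_id, hsnd,
        variance_fun_id_gaussianReal]
      rfl
    rw [variance_map_comp hT measurable_snd, variance_lin hL' hz', hcross L hLm hL, h1, h2, hs]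
    ring
  · rw [cov_map_comp (A := fun p : Ω × ℝ => A p.1) hT (hA.comp measurable_fst) measurable_snd]
    change cov[fun p : Ω × ℝ => A p.1, fun p => 1 * L p.1 + s * p.2; P.prod ν] = _
    rw [cov_lin_right hL' hz' (hA2.comp_fst ν), hcross A hA hA2,
      ← cov_map_comp (A := A) (B := L) measurable_fst hA hLm, hfst]
    ring

/-- The best linear predictor, from the observed variables, of an omitted variable compatible with
the long coefficient `b` and the long R-squared `R`. -/
lemma ObservedMoments.exists_predictor {Ω : Type*} [MeasurableSpace Ω] {d : ℕ} {μ : Measure Ω}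
    [IsProbabilityMeasure μ] {Y X : Ω → ℝ} {W : Fin d → Ω → ℝ} (h : ObservedMoments μ Y X W)
    (hY : Measurable Y) (hX : Measurable X) (hW : ∀ j, Measurable (W j)) {R : ℝ}
    (hR : R ∈ Set.Ioc (rSqMed μ Y X W) 1) (b : ℝ) :
    ∃ (L : Ω → ℝ) (g : ℝ), Measurable L ∧ MemLp L 2 μ ∧ Var[L; μ] ≤ 1 ∧
      (∀ j, cov[W j, L; μ] = 0) ∧
      g ^ 2 = (R - rSqMed μ Y X W) * Var[Y; μ] + (betaMed μ Y X W - b) ^ 2 * Var[xPerp μ X W; μ] ∧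
      cov[X, L; μ] ^ 2 < Var[xPerp μ X W; μ] ∧
      g * cov[X, L; μ] = (betaMed μ Y X W - b) * Var[xPerp μ X W; μ] ∧
      cov[Y, L; μ] = b * cov[X, L; μ] + g := by
  have hvY := h.variance_y_pos
  have hv := h.variance_xPerp_pos
  set B := betaMed μ Y X W - b with hB
  set v := Var[xPerp μ X W; μ] with hvdef
  set D := (R - rSqMed μ Y X W) * Var[Y; μ] with hD
  have hDpos : 0 < D := mul_pos (sub_pos.mpr hR.1) hvY
  -- The value of γ₂,long dictated by `gammaLong₂_sq`. The positive root loses nothing, since W₂ may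
  -- be replaced by −W₂.
  set g := √(D + B ^ 2 * v) with hg
  have hgpos : 0 < g := Real.sqrt_pos.mpr (by positivity)
  have hg2 : g ^ 2 = D + B ^ 2 * v := Real.sq_sqrt (by positivity)
  -- The medium residual. It and X^{⊥W₁} are uncorrelated with each other and with W₁, so
  -- combinations of the two satisfy exogeneity.
  set e : Ω → ℝ := fun ω => Y ω - index (olsCoef μ Y (medVec X W)) (medVec X W) ω with he
  have hfit := OmittedVariable.memLp_index h.memLp_med (olsCoef μ Y (medVec X W))
  have heL : MemLp e 2 μ := h.memLp_y.sub hfit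
  have hxp : MemLp (xPerp μ X W) 2 μ := h.memLp_x.sub (h.memLp_index _)
  have hme (i) : cov[medVec X W i, e; μ] = 0 := by
    rw [he, covariance_fun_sub_right (h.memLp_med i) h.memLp_y hfit,
      cov_index_olsCoef h.memLp_med h.posDef_med, sub_self]
  have hxe : cov[X, e; μ] = 0 := hme (Sum.inl ())
  have hwe (j) : cov[W j, e; μ] = 0 := hme (Sum.inr j)
  have hie (c : Fin d → ℝ) : cov[index c W, e; μ] = 0 := by
    rw [cov_index_left h.memLp_w heL]
    exact Finset.sum_eq_zero fun j _ => by rw [hwe, mul_zero]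
  have hpe : cov[xPerp μ X W, e; μ] = 0 := by
    unfold xPerp
    rw [covariance_fun_sub_left h.memLp_x (h.memLp_index _) heL, hxe, hie, sub_zero]
  have hye : cov[Y, e; μ] = (1 - rSqMed μ Y X W) * Var[Y; μ] := by
    rw [he, covariance_fun_sub_right h.memLp_y h.memLp_y hfit, covariance_comm Y (index _ _),
      ← rSquared_mul_variance h.memLp_med h.memLp_y h.posDef_med hvY.ne',
      covariance_self h.memLp_y.aemeasurable, rSqMed]
    ring
  have hee : Var[e; μ] = (1 - rSqMed μ Y X W) * Var[Y; μ] := by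
    rw [← hye, ← covariance_self heL.aemeasurable]
    nth_rw 1 [he]
    rw [covariance_fun_sub_left h.memLp_y hfit heL, cov_index_left h.memLp_med heL]
    simp [hme]
  set S := (1 - rSqMed μ Y X W) * Var[Y; μ] with hS
  -- The only use of R ≤ 1: W₂ cannot explain more than the medium residual variance S.
  have hDS : D ≤ S := mul_le_mul_of_nonneg_right (by linarith [hR.2]) hvY.le
  have hSpos : 0 < S := hDpos.trans_le hDS
  have hwx (j) : cov[W j, xPerp μ X W; μ] = 0 := by
    unfold xPerp
    rw [covariance_fun_sub_right (h.memLp_w j) h.memLp_x (h.memLp_index _), piOne,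
      cov_index_olsCoef h.memLp_w h.posDef_w, sub_self]
  have hxx : cov[X, xPerp μ X W; μ] = v := by
    rw [hvdef, h.variance_xPerp]
    unfold xPerp
    rw [covariance_fun_sub_right h.memLp_x h.memLp_x (h.memLp_index _), h.cov_x_index_pi,
      covariance_self h.memLp_x.aemeasurable]
  have hyx : cov[Y, xPerp μ X W; μ] = betaMed μ Y X W * v := by
    rw [hvdef, h.variance_xPerp]
    unfold xPerp
    rw [covariance_fun_sub_right h.memLp_y h.memLp_x (h.memLp_index _), covariance_comm Y X,
      covariance_comm Y, h.cov_x_y, h.cov_index_y, h.cov_x_index_pi,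
      covariance_comm (index (piOne μ X W) W) (index _ _), ← h.cov_index_x]
    ring
  have hLX : cov[X, fun ω => B / g * xPerp μ X W ω + D / (g * S) * e ω; μ] = B / g * v := by
    rw [cov_lin_right hxp heL h.memLp_x, hxx, hxe]
    ring
  -- The weight on X^{⊥W₁} solves g cov(X, L) = Bv. The weight on `e` then solves the equation for
  -- cov(Y, L), where g − B²v/g = D/g is left to be covered by cov(Y, e) = S.
  refine ⟨fun ω => B / g * xPerp μ X W ω + D / (g * S) * e ω, g, ?_,
    (hxp.const_mul _).add (heL.const_mul _), ?_, fun j => ?_, hg2, ?_, ?_, ?_⟩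
  · have h1 := measurable_index hW (piOne μ X W)
    have h2 := measurable_index (measurable_medVec hX hW) (olsCoef μ Y (medVec X W))
    exact ((hX.sub h1).const_mul _).add ((hY.sub h2).const_mul _)
  · rw [variance_lin hxp heL, hpe, hee]
    have : (B / g) ^ 2 * v + 2 * (B / g) * (D / (g * S)) * 0 + (D / (g * S)) ^ 2 * S =
        (B ^ 2 * v + D * (D / S)) / g ^ 2 := by
      field_simp
      ring
    rw [this, div_le_one (by positivity), hg2]
    have : D * (D / S) ≤ D * 1 := by
      gcongr
      exact (div_le_one hSpos).mpr hDS
    linarith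
  · rw [cov_lin_right hxp heL (h.memLp_w j), hwx, hwe]
    ring
  -- After clearing g² the claim is 0 < vD, so strictness comes from R > R²_med.
  · rw [hLX, mul_pow, div_pow, div_mul_eq_mul_div, div_lt_iff₀ (by positivity), hg2]
    nlinarith [mul_pos hv hDpos]
  · rw [hLX]
    field_simp
  · rw [hLX, cov_lin_right hxp heL h.memLp_y, hyx, hye]
    field_simp
    rw [hg2, hB]
    ring

lemma measurable_obsY {d : ℕ} : Measurable (obsY (d := d)) := measurable_fst

lemma measurable_obsX {d : ℕ} : Measurable (obsX (d := d)) := measurable_fst.comp measurable_snd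

lemma measurable_obsW {d : ℕ} (j : Fin d) : Measurable (obsW j) :=
  (measurable_pi_apply j).comp (measurable_snd.comp measurable_snd)

end OmittedVariable

/-! ### The identified set. -/

open OmittedVariable in
theorem mainTheorem7 (d : ℕ) (P : MeasureTheory.Measure (OmittedVariable.Obs d))
    [MeasureTheory.IsProbabilityMeasure P]
    (hP : OmittedVariable.ObservedMoments P OmittedVariable.obsY OmittedVariable.obsX
      OmittedVariable.obsW)
    (δ R M : ℝ)
    (hR : R ∈ Set.Ioc (OmittedVariable.rSqMed P OmittedVariable.obsY OmittedVariable.obsX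
      OmittedVariable.obsW) 1)
    (hM : 0 ≤ M) :
    OmittedVariable.identifiedSet P δ R M =
      OmittedVariable.cubicSet P OmittedVariable.obsY OmittedVariable.obsX
          OmittedVariable.obsW δ R
        ∩ Set.Icc
          (OmittedVariable.betaMed P OmittedVariable.obsY OmittedVariable.obsX
            OmittedVariable.obsW - M)
          (OmittedVariable.betaMed P OmittedVariable.obsY OmittedVariable.obsX
            OmittedVariable.obsW + M) := by
  have hβ (Q : Measure (Full d)) (hQ : Q.map Prod.fst = P) :
      betaMed P obsY obsX obsW = betaMed Q fullY fullX fullW := by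
    rw [← hQ]
    exact betaMed_map measurable_fst measurable_obsY measurable_obsX measurable_obsW
  have hρ (Q : Measure (Full d)) (hQ : Q.map Prod.fst = P) :
      rSqMed P obsY obsX obsW = rSqMed Q fullY fullX fullW := by
    rw [← hQ]
    exact rSqMed_map measurable_fst measurable_obsY measurable_obsX measurable_obsW
  have hC (Q : Measure (Full d)) (hQ : Q.map Prod.fst = P) :
      cubicSet P obsY obsX obsW δ R = cubicSet Q fullY fullX fullW δ R := by
    rw [← hQ]
    exact cubicSet_map measurable_fst measurable_obsY measurable_obsX measurable_obsW δ R
  ext b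
  constructor
  · rintro ⟨Q, _, hQ, hm, hS, hN, hE, hU, hMag, hRl, rfl⟩
    refine ⟨?_, ?_⟩
    · rw [hC Q hQ, ← hRl]
      refine (hm.selection_iff_mem_cubicSet hE hU ?_ δ).mp ⟨hS, hN⟩
      rw [hRl, ← hρ Q hQ]
      exact hR.1
    · rw [hβ Q hQ, Set.mem_Icc]
      have := abs_le.mp hMag
      constructor <;> linarith [this.1, this.2]
  · rintro ⟨hb, hbM⟩
    obtain ⟨L, g, hLm, hL, hV, hLW, hg, hLX, hgX, hLY⟩ :=
      hP.exists_predictor measurable_obsY measurable_obsX measurable_obsW hR b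
    obtain ⟨Q, hQp, hQ, hU, hU1, hcov⟩ := exists_extension P hLm hL hV
    have hoQ : ObservedMoments Q fullY fullX fullW :=
      (observedMoments_map measurable_fst measurable_obsY measurable_obsX measurable_obsW).mp
        (hQ.symm ▸ hP)
    have hxp : Var[xPerp P obsX obsW; P] = Var[xPerp Q fullX fullW; Q] := by
      rw [hP.variance_xPerp, hoQ.variance_xPerp, ← hQ, piOne,
        olsCoef_map measurable_fst measurable_obsX measurable_obsW,
        variance_map_comp measurable_fst measurable_obsX,
        variance_map_comp measurable_fst (measurable_index measurable_obsW _)]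
      rfl
    have hvY : Var[obsY; P] = Var[fullY; Q] := by
      rw [← hQ]
      exact variance_map_comp measurable_fst measurable_obsY
    have hcX : cov[fullX, fullU; Q] = cov[obsX, L; P] := hcov _ measurable_obsX hP.memLp_x
    have hcY : cov[fullY, fullU; Q] = cov[obsY, L; P] := hcov _ measurable_obsY hP.memLp_y
    have hE : ExogenousControls Q fullW fullU := fun j =>
      (hcov _ (measurable_obsW j) (hP.memLp_w j)).trans (hLW j)
    have hN : Normalization Q fullU := hU1
    rw [hβ Q hQ, hxp, ← hcX] at hgX
    rw [← hcX, ← hcY, covariance_comm] at hLY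
    rw [← hcX, hxp] at hLX
    rw [hρ Q hQ, hvY, hxp, hβ Q hQ] at hg
    have hm : Moments Q fullY fullX fullW fullU := hoQ.moments hU hE hN hLX
    obtain ⟨hbl, hgl⟩ := hm.olsCoef_long_eq hE hN hgX hLY
    -- The long R-squared is not imposed in the construction: it follows by equating `gammaLong₂_sq`
    -- with the choice of `g` and cancelling var(Y).
    have hRl : rSqLong Q fullY fullX fullW fullU = R := by
      have h1 := hm.gammaLong₂_sq hE hN
      rw [hgl, hbl, hg] at h1
      have h2 := mul_right_cancel₀ hoQ.variance_y_pos.ne' (add_right_cancel h1)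
      linarith
    have hsel : SelectionRatio Q fullY fullX fullW fullU δ ∧
        NonzeroIndices Q fullY fullX fullW fullU := by
      refine (hm.selection_iff_mem_cubicSet hE hN ?_ δ).mpr ?_
      · rw [hRl, ← hρ Q hQ]
        exact hR.1
      · rw [hbl, hRl, ← hC Q hQ]
        exact hb
    refine ⟨Q, hQp, hQ, hm, hsel.1, hsel.2, hE, hN, ?_, hRl, hbl⟩
    rw [MagnitudeRestriction, hbl, ← hβ Q hQ, abs_le]
    constructor <;> linarith [hbM.1, hbM.2]
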